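/- Let $(M,g_1)$ and $(B,g_2)$ be smooth finite-dimensional Riemannian manifolds, $\nabla^B$ the Levi-Civita connection of $B$, and let $(B,\psi,\xi,\eta,g_2)$ be a trans-Sasakian manifold of type $(\alpha,\beta)$. That is, $\dim B$ is odd, $\alpha,\beta$ are smooth functions on $B$, $\psi$ is a smooth $(1,1)$-tensor field, $\xi$ a smooth vector field and $\eta$ a smooth $1$-form with $$\psi^2=-I+\eta\otimes\xi,\quad \psi\xi=0,\quad \eta\circ\psi=0,\quad \eta(\xi)=1,$$ $$g_2(\psi X,\psi Z)=g_2(X,Z)-\eta(X)\eta(Z),\quad g_2(\psi X,Z)=-g_2(X,\psi Z),\quad \eta(X)=g_2(X,\xi),$$ $$(\nabla^B_X\psi)Z=\alpha\big(g_2(X,Z)\xi-\eta(Z)X\big)+\beta\big(g_2(\psi X,Z)\xi-\eta(Z)\psi X\big),$$ $$(\nabla^B_X\eta)Z=-\alpha g_2(\psi X,Z)+\beta g_2(\psi X,\psi Z),\quad \nabla^B_X\xi=-\alpha\psi X+\beta(X-\eta(X)\xi).$$ Let $\pi:M\to B$ be a smooth map with differential $\pi_*$ such that: * $\pi$ is a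 Riemannian map: for every $p\in M$, $g_2(\pi_*v,\pi_*w)=g_1(v,w)$ for all $v,w\in(\ker\pi_{*p})^\perp$; * $\pi$ is anti-invariant: $\psi(\mathrm{range}\,\pi_{*p})\subset(\mathrm{range}\,\pi_{*p})^\perp$ for every $p\in M$; * the Reeb field is horizontal: $\xi_{\pi(p)}\in(\mathrm{range}\,\pi_{*p})^\perp$ for every $p\in M$; * $\pi$ is Clairaut: there is a function $r:B\to(0,\infty)$ such that for every geodesic $\Omega:J\to B$ on an open interval $J$, the function $(r\circ\Omega)\sin\theta$, considered at the parameters $s$ at which $\Omega(s)=\pi(p)$ for some $p\in M$, is constant, where $\theta(s)$ is the angle between $\dot\Omega(s)$ and its component in $(\mathrm{range}\,\pi_{*p})^\perp$ (with $\theta(s)=\pi/2$, a right angle, if this component vanishes); * $\mathrm{range}\,\pi_*$ is integrable: for all open $N\subset M$ and $O\subset B$ with $\pi(N)\subset O$, if $X,Y$ are smooth vector fields on $O$ with $X_{\pi(q)},Y_{\pi(q)}\in\mathrm{range}\,\pi_{*q}$ for all $q\in N$, then $[X,Y]_{\pi(q)}\in\mathrm{range}\,\pi_{*q}$ for all $q\in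 N$. For a vector field $V$ along $\pi$ (a section of $\pi^{-1}TB$) and $w\in T_pM$, let $\nabla^{\pi\perp}_wV$ be the orthogonal projection on $(\mathrm{range}\,\pi_{*p})^\perp$ of the derivative of $V$ in direction $w$ for the pullback of $\nabla^B$ along $\pi$. For $U\in(\mathrm{range}\,\pi_{*p})^\perp$ let $\mathcal CU$ be the orthogonal projection of $\psi U$ on $(\mathrm{range}\,\pi_{*p})^\perp$. Then $$g_2\big(\nabla^{\pi\perp}_W\psi(\pi_*Y)-\nabla^{\pi\perp}_Y\psi(\pi_*W),\ \mathcal CU\big)=0$$ at every point $p\in M$, for all smooth sections $W,Y$ of $(\ker\pi_*)^\perp$ and all $U\in(\mathrm{range}\,\pi_{*p})^\perp$. -/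

import Mathlib

open scoped Manifold ContDiff Bundle
open Bundle (RiemannianBundle)

namespace ClairautMap

noncomputable section

/-! ### Riemannian geometry of the target -/

section Target

variable {E : Type*} [NormedAddCommGroup E] [NormedSpace ℝ E] [FiniteDimensional ℝ E]
  {B : Type*} [TopologicalSpace B] [ChartedSpace E B] [IsManifold 𝓘(ℝ, E) ∞ B]
  [RiemannianBundle (fun x : B ↦ TangentSpace 𝓘(ℝ, E) x)]
  [IsContMDiffRiemannianBundle 𝓘(ℝ, E) ∞ E (fun x : B ↦ TangentSpace 𝓘(ℝ, E) x)]

/-- The Levi-Civita connection: the torsion-free connection on the tangent bundle that is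
compatible with the Riemannian metric. Recall that `∇_w Z` at `x` is written `cov Z x w`. -/
structure IsLeviCivita
    (cov : CovariantDerivative 𝓘(ℝ, E) E (TangentSpace 𝓘(ℝ, E) : B → Type _)) : Prop where
  torsion_eq_zero : cov.torsion = 0
  metric : ∀ (Y Z : Π x : B, TangentSpace 𝓘(ℝ, E) x) (x : B) (w : TangentSpace 𝓘(ℝ, E) x),
    MDifferentiableAt 𝓘(ℝ, E) 𝓘(ℝ, E).tangent
      (fun y ↦ (⟨y, Y y⟩ : TangentBundle 𝓘(ℝ, E) B)) x →
    MDifferentiableAt 𝓘(ℝ, E) 𝓘(ℝ, E).tangent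
      (fun y ↦ (⟨y, Z y⟩ : TangentBundle 𝓘(ℝ, E) B)) x →
    mvfderiv 𝓘(ℝ, E) (fun y ↦ (inner ℝ (Y y) (Z y) : ℝ)) x w =
      inner ℝ (cov Y x w) (Z x) + inner ℝ (Y x) (cov Z x w)

/-- `(ψ, ξ, η, g)` is an almost contact metric structure on `B`, where `g` is the Riemannian
metric of `B`: `ψ` is a smooth `(1,1)`-tensor field, `ξ` a smooth vector field (the Reeb field),
`η` a smooth one-form, and the dimension of `B` is odd. -/
structure IsAlmostContactMetric
    (ψ : Π x : B, TangentSpace 𝓘(ℝ, E) x →L[ℝ] TangentSpace 𝓘(ℝ, E) x)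
    (ξ : Π x : B, TangentSpace 𝓘(ℝ, E) x)
    (η : Π x : B, TangentSpace 𝓘(ℝ, E) x →L[ℝ] ℝ) : Prop where
  odd_dim : Odd (Module.finrank ℝ E)
  smooth_psi : ContMDiff 𝓘(ℝ, E) (𝓘(ℝ, E).prod 𝓘(ℝ, E →L[ℝ] E)) ∞
    (fun x ↦ (⟨x, ψ x⟩ : Bundle.TotalSpace (E →L[ℝ] E)
      (fun x : B ↦ TangentSpace 𝓘(ℝ, E) x →L[ℝ] TangentSpace 𝓘(ℝ, E) x)))
  smooth_xi : ContMDiff 𝓘(ℝ, E) 𝓘(ℝ, E).tangent ∞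
    (fun x ↦ (⟨x, ξ x⟩ : TangentBundle 𝓘(ℝ, E) B))
  smooth_eta : ContMDiff 𝓘(ℝ, E) (𝓘(ℝ, E).prod 𝓘(ℝ, E →L[ℝ] ℝ)) ∞
    (fun x ↦ (⟨x, η x⟩ : Bundle.TotalSpace (E →L[ℝ] ℝ)
      (fun x : B ↦ TangentSpace 𝓘(ℝ, E) x →L[ℝ] Bundle.Trivial B ℝ x)))
  psi_sq : ∀ x v, ψ x (ψ x v) = -v + η x v • ξ x
  psi_xi : ∀ x, ψ x (ξ x) = 0
  eta_psi : ∀ x v, η x (ψ x v) = 0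
  eta_xi : ∀ x, η x (ξ x) = 1
  inner_psi_psi : ∀ x v w, inner ℝ (ψ x v) (ψ x w) = inner ℝ v w - η x v * η x w
  inner_psi_left : ∀ x v w, inner ℝ (ψ x v) w = -inner ℝ v (ψ x w)
  eta_eq_inner : ∀ x v, η x v = inner ℝ v (ξ x)

/-- `(B, ψ, ξ, η, g)` is a trans-Sasakian manifold of type `(α, β)`; `cov` is meant to be the
Levi-Civita connection of `B`. Here `(∇_w ψ) Z = ∇_w (ψ Z) - ψ (∇_w Z)` and
`(∇_w η) Z = w (η Z) - η (∇_w Z)`, for a tangent vector `w` at `x` and a vector field `Z` that is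
differentiable at `x`. -/
structure IsTransSasakian
    (cov : CovariantDerivative 𝓘(ℝ, E) E (TangentSpace 𝓘(ℝ, E) : B → Type _))
    (ψ : Π x : B, TangentSpace 𝓘(ℝ, E) x →L[ℝ] TangentSpace 𝓘(ℝ, E) x)
    (ξ : Π x : B, TangentSpace 𝓘(ℝ, E) x)
    (η : Π x : B, TangentSpace 𝓘(ℝ, E) x →L[ℝ] ℝ)
    (α β : B → ℝ) : Prop extends IsAlmostContactMetric ψ ξ η where
  smooth_alpha : ContMDiff 𝓘(ℝ, E) 𝓘(ℝ, ℝ) ∞ α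
  smooth_beta : ContMDiff 𝓘(ℝ, E) 𝓘(ℝ, ℝ) ∞ β
  cov_psi : ∀ (Z : Π x : B, TangentSpace 𝓘(ℝ, E) x) (x : B) (w : TangentSpace 𝓘(ℝ, E) x),
    MDifferentiableAt 𝓘(ℝ, E) 𝓘(ℝ, E).tangent
      (fun y ↦ (⟨y, Z y⟩ : TangentBundle 𝓘(ℝ, E) B)) x →
    cov (fun y ↦ ψ y (Z y)) x w - ψ x (cov Z x w) =
      α x • ((inner ℝ w (Z x) : ℝ) • ξ x - η x (Z x) • w)
        + β x • ((inner ℝ (ψ x w) (Z x) : ℝ) • ξ x - η x (Z x) • ψ x w)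
  cov_eta : ∀ (Z : Π x : B, TangentSpace 𝓘(ℝ, E) x) (x : B) (w : TangentSpace 𝓘(ℝ, E) x),
    MDifferentiableAt 𝓘(ℝ, E) 𝓘(ℝ, E).tangent
      (fun y ↦ (⟨y, Z y⟩ : TangentBundle 𝓘(ℝ, E) B)) x →
    mvfderiv 𝓘(ℝ, E) (fun y ↦ η y (Z y)) x w - η x (cov Z x w) =
      -α x * inner ℝ (ψ x w) (Z x) + β x * inner ℝ (ψ x w) (ψ x (Z x))
  cov_xi : ∀ (x : B) (w : TangentSpace 𝓘(ℝ, E) x),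
    cov ξ x w = -(α x • ψ x w) + β x • (w - η x w • ξ x)

/-- The pullback connection `∇^f` along a map `f : N → B`, on sections `s` of `f⁻¹ TB` (vector
fields along `f`): in the trivialization of `TB` over the preferred chart at `f q`, with coordinate
frame `e_i` and `s = ∑ sⁱ (e_i ∘ f)`, it is
`∇^f_v s = ∑ ds^i(v) e_i + ∑ sⁱ(q) ∇_{df(v)} e_i`.
Here `FiberBundle.extend E (s q)` is the local field `∑ sⁱ(q) e_i` with constant coefficients. -/
def covAlong (cov : CovariantDerivative 𝓘(ℝ, E) E (TangentSpace 𝓘(ℝ, E) : B → Type _))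
    {F : Type*} [NormedAddCommGroup F] [NormedSpace ℝ F]
    {N : Type*} [TopologicalSpace N] [ChartedSpace F N]
    (f : N → B) (s : Π q : N, TangentSpace 𝓘(ℝ, E) (f q)) (q : N)
    (v : TangentSpace 𝓘(ℝ, F) q) : TangentSpace 𝓘(ℝ, E) (f q) :=
  (trivializationAt E (TangentSpace 𝓘(ℝ, E) : B → Type _) (f q)).symm (f q)
      (mvfderiv 𝓘(ℝ, F) (fun q' ↦
        ((trivializationAt E (TangentSpace 𝓘(ℝ, E) : B → Type _) (f q))
          (⟨f q', s q'⟩ : TangentBundle 𝓘(ℝ, E) B)).2) q v)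
    + cov (FiberBundle.extend E (s q)) (f q) (mfderiv 𝓘(ℝ, F) 𝓘(ℝ, E) f q v)

/-- The velocity field of a curve. -/
def velocity (Ω : ℝ → B) (t : ℝ) : TangentSpace 𝓘(ℝ, E) (Ω t) :=
  mfderiv 𝓘(ℝ, ℝ) 𝓘(ℝ, E) Ω t (1 : ℝ)

/-- `Ω` is a geodesic on the open set `J` of parameters: it is smooth there and
`∇_{d/dt} Ω' = 0`. -/
def IsGeodesicOn (cov : CovariantDerivative 𝓘(ℝ, E) E (TangentSpace 𝓘(ℝ, E) : B → Type _))
    (Ω : ℝ → B) (J : Set ℝ) : Prop :=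
  ContMDiffOn 𝓘(ℝ, ℝ) 𝓘(ℝ, E) ∞ Ω J ∧
    ∀ t ∈ J, covAlong cov Ω (velocity (E := E) Ω) t (1 : ℝ) = 0

end Target

/-! ### Riemannian maps -/

section Maps

variable {E₁ : Type*} [NormedAddCommGroup E₁] [NormedSpace ℝ E₁] [FiniteDimensional ℝ E₁]
  {M : Type*} [TopologicalSpace M] [ChartedSpace E₁ M] [IsManifold 𝓘(ℝ, E₁) ∞ M]
  [RiemannianBundle (fun x : M ↦ TangentSpace 𝓘(ℝ, E₁) x)]
  [IsContMDiffRiemannianBundle 𝓘(ℝ, E₁) ∞ E₁ (fun x : M ↦ TangentSpace 𝓘(ℝ, E₁) x)]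
  {E : Type*} [NormedAddCommGroup E] [NormedSpace ℝ E] [FiniteDimensional ℝ E]
  {B : Type*} [TopologicalSpace B] [ChartedSpace E B] [IsManifold 𝓘(ℝ, E) ∞ B]
  [RiemannianBundle (fun x : B ↦ TangentSpace 𝓘(ℝ, E) x)]
  [IsContMDiffRiemannianBundle 𝓘(ℝ, E) ∞ E (fun x : B ↦ TangentSpace 𝓘(ℝ, E) x)]

/-- The range of `f_{*p}`, a subspace of `T_{f p} B`. -/
def rangeAt (E₁ E : Type*) [NormedAddCommGroup E₁] [NormedSpace ℝ E₁]
    {M : Type*} [TopologicalSpace M] [ChartedSpace E₁ M]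
    [NormedAddCommGroup E] [NormedSpace ℝ E]
    {B : Type*} [TopologicalSpace B] [ChartedSpace E B]
    (f : M → B) (p : M) : Submodule ℝ (TangentSpace 𝓘(ℝ, E) (f p)) :=
  LinearMap.range (mfderiv 𝓘(ℝ, E₁) 𝓘(ℝ, E) f p).toLinearMap

/-- The horizontal space `(ker f_{*p})^⊥`, a subspace of `T_p M`. -/
def horizontalAt (E₁ E : Type*) [NormedAddCommGroup E₁] [NormedSpace ℝ E₁]
    {M : Type*} [TopologicalSpace M] [ChartedSpace E₁ M] [IsManifold 𝓘(ℝ, E₁) ∞ M]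
    [RiemannianBundle (fun x : M ↦ TangentSpace 𝓘(ℝ, E₁) x)]
    [NormedAddCommGroup E] [NormedSpace ℝ E]
    {B : Type*} [TopologicalSpace B] [ChartedSpace E B]
    (f : M → B) (p : M) : Submodule ℝ (TangentSpace 𝓘(ℝ, E₁) p) :=
  (LinearMap.ker (mfderiv 𝓘(ℝ, E₁) 𝓘(ℝ, E) f p).toLinearMap)ᗮ

instance (f : M → B) (p : M) : (rangeAt E₁ E f p).HasOrthogonalProjection := by
  have : FiniteDimensional ℝ (TangentSpace 𝓘(ℝ, E) (f p)) :=
    inferInstanceAs (FiniteDimensional ℝ E)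
  infer_instance

/-- A smooth map `f : M → B` is a Riemannian map if each `f_{*p}` is isometric on the horizontal
space `(ker f_{*p})^⊥`. -/
structure IsRiemannianMap (f : M → B) : Prop where
  smooth : ContMDiff 𝓘(ℝ, E₁) 𝓘(ℝ, E) ∞ f
  isometric : ∀ (p : M), ∀ v ∈ horizontalAt E₁ E f p, ∀ w ∈ horizontalAt E₁ E f p,
    (inner ℝ (mfderiv 𝓘(ℝ, E₁) 𝓘(ℝ, E) f p v) (mfderiv 𝓘(ℝ, E₁) 𝓘(ℝ, E) f p w) : ℝ) = inner ℝ v w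

/-- Anti-invariance: `ψ (range f_{*p}) ⊆ (range f_{*p})^⊥` for all `p`. -/
def IsAntiInvariant (f : M → B)
    (ψ : Π x : B, TangentSpace 𝓘(ℝ, E) x →L[ℝ] TangentSpace 𝓘(ℝ, E) x) : Prop :=
  ∀ (p : M), ∀ v ∈ rangeAt E₁ E f p, ψ (f p) v ∈ (rangeAt E₁ E f p)ᗮ

/-- The angle between a vector `u` of `T_b B` and its component in `(range f_{*p})^⊥`, at a point
`b = f p` of the image of `f`. (If that component vanishes, the angle is a right angle.) -/
def clairautAngle (f : M → B) (p : M) {b : B} (h : f p = b) (u : TangentSpace 𝓘(ℝ, E) b) : ℝ :=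
  let u' : TangentSpace 𝓘(ℝ, E) (f p) := h ▸ u
  InnerProductGeometry.angle u' ((rangeAt E₁ E f p)ᗮ.starProjection u')

/-- The Clairaut condition: there is a positive function `r` on `B` such that, for every geodesic
`Ω : J → B` on an open interval, the function `(r ∘ Ω) sin θ` is constant; here `θ` is the angle
between `Ω'` and its component in `(range f_*)^⊥`, and the function is considered at all parameters
where it is defined, that is, where `Ω` meets the image of `f`. -/
def IsClairaut (cov : CovariantDerivative 𝓘(ℝ, E) E (TangentSpace 𝓘(ℝ, E) : B → Type _))
    (f : M → B) : Prop :=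
  ∃ r : B → ℝ, (∀ b, 0 < r b) ∧
    ∀ (J : Set ℝ) (Ω : ℝ → B), IsOpen J → J.OrdConnected → IsGeodesicOn cov Ω J →
      ∃ c : ℝ, ∀ t ∈ J, ∀ (p : M) (h : f p = Ω t),
        r (Ω t) * Real.sin (clairautAngle (E₁ := E₁) f p h (velocity (E := E) Ω t)) = c

/-- Integrability (involutivity) of `range f_*`: the Lie bracket of two local vector fields of `B`
that take values in `range f_*` along `f` (over an open set `N` of `M`) again takes values in
`range f_*` there. -/
def IsIntegrableRange (E₁ E : Type*) [NormedAddCommGroup E₁] [NormedSpace ℝ E₁]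
    {M : Type*} [TopologicalSpace M] [ChartedSpace E₁ M]
    [NormedAddCommGroup E] [NormedSpace ℝ E]
    {B : Type*} [TopologicalSpace B] [ChartedSpace E B] [IsManifold 𝓘(ℝ, E) ∞ B]
    (f : M → B) : Prop :=
  ∀ (N : Set M) (O : Set B), IsOpen N → IsOpen O → Set.MapsTo f N O →
    ∀ X Y : Π x : B, TangentSpace 𝓘(ℝ, E) x,
      ContMDiffOn 𝓘(ℝ, E) 𝓘(ℝ, E).tangent ∞ (fun x ↦ (⟨x, X x⟩ : TangentBundle 𝓘(ℝ, E) B)) O →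
      ContMDiffOn 𝓘(ℝ, E) 𝓘(ℝ, E).tangent ∞ (fun x ↦ (⟨x, Y x⟩ : TangentBundle 𝓘(ℝ, E) B)) O →
      (∀ q ∈ N, X (f q) ∈ rangeAt E₁ E f q) → (∀ q ∈ N, Y (f q) ∈ rangeAt E₁ E f q) →
      ∀ q ∈ N, VectorField.mlieBracket 𝓘(ℝ, E) X Y (f q) ∈ rangeAt E₁ E f q

/-- `W` is a smooth horizontal vector field on `M`, a section of `(ker f_*)^⊥`. -/
structure IsHorizontalField (E : Type*) [NormedAddCommGroup E] [NormedSpace ℝ E]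
    {B : Type*} [TopologicalSpace B] [ChartedSpace E B]
    (f : M → B) (W : Π p : M, TangentSpace 𝓘(ℝ, E₁) p) : Prop where
  smooth : ContMDiff 𝓘(ℝ, E₁) 𝓘(ℝ, E₁).tangent ∞
    (fun p ↦ (⟨p, W p⟩ : TangentBundle 𝓘(ℝ, E₁) M))
  horizontal : ∀ p, W p ∈ horizontalAt E₁ E f p

/-- The section `f_* W` of `f⁻¹ TB`. -/
def push (E : Type*) [NormedAddCommGroup E] [NormedSpace ℝ E]
    {B : Type*} [TopologicalSpace B] [ChartedSpace E B]
    (f : M → B) (W : Π p : M, TangentSpace 𝓘(ℝ, E₁) p) (p : M) : TangentSpace 𝓘(ℝ, E) (f p) :=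
  mfderiv 𝓘(ℝ, E₁) 𝓘(ℝ, E) f p (W p)

/-- `∇^{f⊥}_w V`: the component in `(range f_*)^⊥` of the derivative `∇^f_w V` of a vector field
`V` along `f`. -/
def normalCov (cov : CovariantDerivative 𝓘(ℝ, E) E (TangentSpace 𝓘(ℝ, E) : B → Type _))
    (f : M → B) (V : Π p : M, TangentSpace 𝓘(ℝ, E) (f p)) (p : M)
    (w : TangentSpace 𝓘(ℝ, E₁) p) : TangentSpace 𝓘(ℝ, E) (f p) :=
  (rangeAt E₁ E f p)ᗮ.starProjection (covAlong cov f V p w)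

/-- `𝒞U`: the component of `ψ U` in `(range f_{*p})^⊥`, for a tangent vector `U` at `f p`. -/
def normalPart (E₁ : Type*) [NormedAddCommGroup E₁] [NormedSpace ℝ E₁] [FiniteDimensional ℝ E₁]
    {M : Type*} [TopologicalSpace M] [ChartedSpace E₁ M] (f : M → B)
    (ψ : Π x : B, TangentSpace 𝓘(ℝ, E) x →L[ℝ] TangentSpace 𝓘(ℝ, E) x) (p : M)
    (U : TangentSpace 𝓘(ℝ, E) (f p)) : TangentSpace 𝓘(ℝ, E) (f p) :=
  (rangeAt E₁ E f p)ᗮ.starProjection (ψ (f p) U)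

end Maps

end

end ClairautMap

/-!
Leibniz' rule along `f` reads `∇^f_w (ψ s) = ψ (∇^f_w s) + (∇_{f_* w} ψ) s`. For `s = f_* X`,
anti-invariance and `ξ ⊥ range f_*` kill every term of the trans-Sasakian formula for the second
summand except `α ⟨f_* w, f_* X⟩ ξ`, which is symmetric in `w` and `X`. Since `∇` has no torsion,
`∇^f_W (f_* Y) - ∇^f_Y (f_* W) = f_* [W, Y]`, so that
`∇^f_W (ψ f_* Y) - ∇^f_Y (ψ f_* W) = ψ f_* [W, Y]`. This vector is normal to `range f_*`, and
`⟨ψ f_* Z, ψ U⟩ = ⟨f_* Z, U⟩ - η (f_* Z) η (U) = 0` for normal `U`.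

In coordinates `∇^f` is the derivative of the components plus a tensorial term, so the identities
for `∇^f` reduce to the product rule and to the symmetry of second derivatives.
-/

namespace ClairautMap

section Calculus

variable {𝕜 : Type*} [NontriviallyNormedField 𝕜]
  {E : Type*} [NormedAddCommGroup E] [NormedSpace 𝕜 E] {H : Type*} [TopologicalSpace H]
  {I : ModelWithCorners 𝕜 E H} {N : Type*} [TopologicalSpace N] [ChartedSpace H N]
  {V V' : Type*} [NormedAddCommGroup V] [NormedSpace 𝕜 V]
  [NormedAddCommGroup V'] [NormedSpace 𝕜 V'] {q : N}

theorem mvfderiv_congr {g h : N → V} (hgh : g =ᶠ[nhds q] h) :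
    mvfderiv I g q = mvfderiv I h q :=
  hgh.mfderiv_eq (I := I) (I' := 𝓘(𝕜, V))

theorem mvfderiv_clm_apply {A : N → V →L[𝕜] V'} {g : N → V} (hA : MDiffAt A q) (hg : MDiffAt g q)
    (v : TangentSpace I q) :
    mvfderiv I (fun q' ↦ A q' (g q')) q v =
      A q (mvfderiv I g q v) + mvfderiv I A q v (g q) := by
  have hAg : HasMFDerivAt I 𝓘(𝕜, (V →L[𝕜] V') × V) (fun q' ↦ (A q', g q')) q
      ((mvfderiv I A q).prod (mvfderiv I g q)) :=
    ⟨hA.continuousAt.prodMk hg.continuousAt, hA.hasMFDerivAt.2.prodMk hg.hasMFDerivAt.2⟩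
  exact congrArg (fun T ↦ T v)
    ((isBoundedBilinearMap_apply.hasFDerivAt (A q, g q)).hasMFDerivAt.comp q hAg).mfderiv

end Calculus

section LieBracket

open VectorField

theorem fderiv_lieBracket_apply {𝕜 : Type*} [NontriviallyNormedField 𝕜]
    {F : Type*} [NormedAddCommGroup F] [NormedSpace 𝕜 F]
    {V : Type*} [NormedAddCommGroup V] [NormedSpace 𝕜 V] {g : F → V} {X Y : F → F} {x : F}
    (hg : DifferentiableAt 𝕜 (fderiv 𝕜 g) x) (hsymm : IsSymmSndFDerivAt 𝕜 g x)
    (hX : DifferentiableAt 𝕜 X x) (hY : DifferentiableAt 𝕜 Y x) :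
    fderiv 𝕜 g x (lieBracket 𝕜 X Y x) =
      fderiv 𝕜 (fun y ↦ fderiv 𝕜 g y (Y y)) x (X x) -
        fderiv 𝕜 (fun y ↦ fderiv 𝕜 g y (X y)) x (Y x) := by
  rw [fderiv_clm_apply hg hX, fderiv_clm_apply hg hY]
  simp [lieBracket, hsymm (X x) (Y x)]

/-- The derivative `X g` of a function `g` in the direction of a vector field `X`. -/
noncomputable def dirDeriv {F : Type*} [NormedAddCommGroup F] [NormedSpace ℝ F]
    {N : Type*} [TopologicalSpace N] [ChartedSpace F N]
    {V : Type*} [NormedAddCommGroup V] [NormedSpace ℝ V]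
    (X : Π q : N, TangentSpace 𝓘(ℝ, F) q) (g : N → V) (q : N) : V :=
  mvfderiv 𝓘(ℝ, F) g q (X q)

variable {F : Type*} [NormedAddCommGroup F] [NormedSpace ℝ F]
  {N : Type*} [TopologicalSpace N] [ChartedSpace F N]
  {V : Type*} [NormedAddCommGroup V] [NormedSpace ℝ V]
  {p q : N} {X Y : Π q : N, TangentSpace 𝓘(ℝ, F) q}

theorem trivializationAt_apply_eq_mvfderiv_extChartAt [IsManifold 𝓘(ℝ, F) 1 N]
    (hq : q ∈ (chartAt F p).source) (v : TangentSpace 𝓘(ℝ, F) q) :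
    (trivializationAt F (TangentSpace 𝓘(ℝ, F)) p ⟨q, v⟩).2 =
      mvfderiv 𝓘(ℝ, F) (extChartAt 𝓘(ℝ, F) p) q v := by
  have h := TangentBundle.continuousLinearMapAt_trivializationAt (I := 𝓘(ℝ, F)) hq
  rw [← Bundle.Trivialization.continuousLinearMapAt_apply_of_mem ℝ _ (by simpa using hq), h]
  rfl

theorem differentiableAt_comp_extChartAt_symm [IsManifold 𝓘(ℝ, F) 1 N] {h : N → V}
    (hq : q ∈ (chartAt F p).source) (hh : MDiffAt h q) :
    DifferentiableAt ℝ (h ∘ (extChartAt 𝓘(ℝ, F) p).symm) (extChartAt 𝓘(ℝ, F) p q) := by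
  have hq' : q ∈ (extChartAt 𝓘(ℝ, F) p).source := by simpa using hq
  have hsymm : MDiffAt (extChartAt 𝓘(ℝ, F) p).symm (extChartAt 𝓘(ℝ, F) p q) := by
    simpa [mdifferentiableWithinAt_univ] using
      mdifferentiableWithinAt_extChartAt_symm ((extChartAt 𝓘(ℝ, F) p).map_source hq')
  exact (MDifferentiableAt.comp_of_eq _ hh hsymm
    ((extChartAt 𝓘(ℝ, F) p).left_inv hq')).differentiableAt

theorem mvfderiv_eq_fderiv_extChartAt [IsManifold 𝓘(ℝ, F) 1 N] {h : N → V}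
    (hq : q ∈ (chartAt F p).source) (hh : MDiffAt h q) (v : TangentSpace 𝓘(ℝ, F) q) :
    mvfderiv 𝓘(ℝ, F) h q v = fderiv ℝ (h ∘ (extChartAt 𝓘(ℝ, F) p).symm)
      (extChartAt 𝓘(ℝ, F) p q) (mvfderiv 𝓘(ℝ, F) (extChartAt 𝓘(ℝ, F) p) q v) := by
  have heq : h =ᶠ[nhds q] (h ∘ (extChartAt 𝓘(ℝ, F) p).symm) ∘ extChartAt 𝓘(ℝ, F) p := by
    filter_upwards [extChartAt_source_mem_nhds' (I := 𝓘(ℝ, F)) (by simpa using hq)] with q' hq'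
    exact congrArg h ((extChartAt 𝓘(ℝ, F) p).left_inv hq').symm
  rw [mvfderiv_congr heq, ← mfderiv_eq_fderiv]
  have hh' := (differentiableAt_comp_extChartAt_symm hq hh).mdifferentiableAt
  exact mfderiv_comp_apply q hh' (mdifferentiableAt_extChartAt hq) v

theorem differentiableAt_dirDeriv_extChartAt [IsManifold 𝓘(ℝ, F) 1 N] (hX : MDiffAt (T% X) p) :
    DifferentiableAt ℝ (dirDeriv X (extChartAt 𝓘(ℝ, F) p) ∘ (extChartAt 𝓘(ℝ, F) p).symm)
      (extChartAt 𝓘(ℝ, F) p p) := by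
  refine differentiableAt_comp_extChartAt_symm (mem_chart_source F p) <|
    ((mdifferentiableAt_section 𝓘(ℝ, F) X).1 hX).congr_of_eventuallyEq ?_
  filter_upwards [(chartAt F p).open_source.mem_nhds (mem_chart_source F p)] with q hq
  exact (trivializationAt_apply_eq_mvfderiv_extChartAt hq (X q)).symm

theorem mpullbackWithin_extChartAt_symm_eventuallyEq [IsManifold 𝓘(ℝ, F) 1 N]
    (X : Π q : N, TangentSpace 𝓘(ℝ, F) q) (p : N) :
    mpullbackWithin 𝓘(ℝ, F) 𝓘(ℝ, F) (extChartAt 𝓘(ℝ, F) p).symm X (Set.range 𝓘(ℝ, F))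
      =ᶠ[nhds (extChartAt 𝓘(ℝ, F) p p)]
        dirDeriv X (extChartAt 𝓘(ℝ, F) p) ∘ (extChartAt 𝓘(ℝ, F) p).symm := by
  filter_upwards [extChartAt_target_mem_nhds p] with y hy
  refine (isInvertible_mfderivWithin_extChartAt_symm hy).inverse_apply_eq.2 ?_
  exact (congrArg (fun T ↦ T (X ((extChartAt 𝓘(ℝ, F) p).symm y)))
    (mfderivWithin_extChartAt_symm_comp_mfderiv_extChartAt hy)).symm

theorem lieBracket_dirDeriv_extChartAt [IsManifold 𝓘(ℝ, F) 1 N]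
    (X Y : Π q : N, TangentSpace 𝓘(ℝ, F) q) (p : N) :
    lieBracket ℝ (dirDeriv X (extChartAt 𝓘(ℝ, F) p) ∘ (extChartAt 𝓘(ℝ, F) p).symm)
        (dirDeriv Y (extChartAt 𝓘(ℝ, F) p) ∘ (extChartAt 𝓘(ℝ, F) p).symm)
        (extChartAt 𝓘(ℝ, F) p p) =
      dirDeriv (mlieBracket 𝓘(ℝ, F) X Y) (extChartAt 𝓘(ℝ, F) p) p := by
  have hpull := Filter.EventuallyEq.lieBracket_vectorField_eq (𝕜 := ℝ)
    (mpullbackWithin_extChartAt_symm_eventuallyEq X p)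
    (mpullbackWithin_extChartAt_symm_eventuallyEq Y p)
  have hbracket := mlieBracketWithin_apply (I := 𝓘(ℝ, F)) (V := X) (W := Y) (s := Set.univ)
    (x₀ := p)
  simp only [Set.preimage_univ, Set.univ_inter, ModelWithCorners.range_eq_univ,
    mlieBracketWithin_univ] at hpull hbracket
  refine hpull.symm.trans <|
    (isInvertible_mfderiv_extChartAt (mem_extChartAt_source p)).inverse_apply_eq.1 ?_
  exact (congrArg _ (congrFun lieBracketWithin_univ _).symm).trans hbracket.symm

theorem dirDeriv_eventuallyEq_fderiv_extChartAt [IsManifold 𝓘(ℝ, F) 1 N] {g : N → V}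
    (hg : ∀ᶠ q in nhds p, MDiffAt g q) (X : Π q : N, TangentSpace 𝓘(ℝ, F) q) :
    dirDeriv X g =ᶠ[nhds p]
      (fun y ↦ fderiv ℝ (g ∘ (extChartAt 𝓘(ℝ, F) p).symm) y
        ((dirDeriv X (extChartAt 𝓘(ℝ, F) p) ∘ (extChartAt 𝓘(ℝ, F) p).symm) y)) ∘
          extChartAt 𝓘(ℝ, F) p := by
  filter_upwards [hg, (chartAt F p).open_source.mem_nhds (mem_chart_source F p)] with q hgq hq
  rw [dirDeriv, mvfderiv_eq_fderiv_extChartAt hq hgq, Function.comp_apply, Function.comp_apply,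
    (extChartAt 𝓘(ℝ, F) p).left_inv (by simpa using hq)]
  rfl

theorem dirDeriv_mlieBracket [IsManifold 𝓘(ℝ, F) 2 N] {g : N → V}
    (hg : ContMDiffAt 𝓘(ℝ, F) 𝓘(ℝ, V) 2 g p) (hX : MDiffAt (T% X) p) (hY : MDiffAt (T% Y) p) :
    dirDeriv (mlieBracket 𝓘(ℝ, F) X Y) g p =
      dirDeriv X (dirDeriv Y g) p - dirDeriv Y (dirDeriv X g) p := by
  set φ := extChartAt 𝓘(ℝ, F) p
  have hp := mem_chart_source F p
  have hg' : ∀ᶠ q in nhds p, MDiffAt g q := by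
    filter_upwards [(contMDiffAt_iff_contMDiffAt_nhds (by simp)).1 hg] with q hq
    exact hq.mdifferentiableAt (by simp)
  have hgφ : ContDiffAt ℝ 2 (g ∘ φ.symm) (φ p) := by
    simpa only [extChartAt_model_space_eq_id, PartialEquiv.refl_coe, Function.id_comp,
      modelWithCornersSelf_coe, Set.range_id, contDiffWithinAt_univ] using
      (contMDiffAt_iff.1 hg).2
  have hdg : DifferentiableAt ℝ (fderiv ℝ (g ∘ φ.symm)) (φ p) :=
    (hgφ.fderiv_right (m := 1) (by norm_num)).differentiableAt (by simp)
  have hiter {Z Z' : Π q : N, TangentSpace 𝓘(ℝ, F) q} (hZ' : MDiffAt (T% Z') p) :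
      dirDeriv Z (dirDeriv Z' g) p =
        fderiv ℝ (fun y ↦ fderiv ℝ (g ∘ φ.symm) y ((dirDeriv Z' φ ∘ φ.symm) y)) (φ p)
          ((dirDeriv Z φ ∘ φ.symm) (φ p)) := by
    have hd := (hdg.clm_apply (differentiableAt_dirDeriv_extChartAt hZ')).mdifferentiableAt
    have hZ : (dirDeriv Z φ ∘ φ.symm) (φ p) = dirDeriv Z φ p :=
      congrArg (dirDeriv Z φ) (extChartAt_to_inv p)
    rw [hZ, ← mfderiv_eq_fderiv, dirDeriv,
      mvfderiv_congr (dirDeriv_eventuallyEq_fderiv_extChartAt hg' Z')]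
    exact mfderiv_comp_apply p hd (mdifferentiableAt_extChartAt hp) (Z p)
  rw [hiter hY, hiter hX, ← fderiv_lieBracket_apply hdg (hgφ.isSymmSndFDerivAt (by simp))
    (differentiableAt_dirDeriv_extChartAt hX) (differentiableAt_dirDeriv_extChartAt hY),
    lieBracket_dirDeriv_extChartAt]
  exact mvfderiv_eq_fderiv_extChartAt hp hg'.self_of_nhds _

end LieBracket

section HomBundle

variable {𝕜 : Type*} [NontriviallyNormedField 𝕜]
  {B : Type*} [TopologicalSpace B] {F : Type*} [NormedAddCommGroup F] [NormedSpace 𝕜 F]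
  {V : B → Type*} [∀ x, AddCommMonoid (V x)] [∀ x, Module 𝕜 (V x)]
  [∀ x, TopologicalSpace (V x)] [TopologicalSpace (Bundle.TotalSpace F V)]
  [FiberBundle F V] [VectorBundle 𝕜 F V]
  {B' : Type*} [TopologicalSpace B'] {F' : Type*} [NormedAddCommGroup F'] [NormedSpace 𝕜 F']
  {V' : B' → Type*} [∀ x, AddCommMonoid (V' x)] [∀ x, Module 𝕜 (V' x)]
  [∀ x, TopologicalSpace (V' x)] [TopologicalSpace (Bundle.TotalSpace F' V')]
  [FiberBundle F' V'] [VectorBundle 𝕜 F' V']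
  {x₀ x : B} {y₀ y : B'}

theorem trivializationAt_clm_apply (hx : x ∈ (trivializationAt F V x₀).baseSet)
    (hy : y ∈ (trivializationAt F' V' y₀).baseSet) (ϕ : V x →L[𝕜] V' y) (u : V x) :
    (trivializationAt F' V' y₀ ⟨y, ϕ u⟩).2 =
      ContinuousLinearMap.inCoordinates F V F' V' x₀ x y₀ y ϕ
        (trivializationAt F V x₀ ⟨x, u⟩).2 := by
  simp only [ContinuousLinearMap.inCoordinates, ContinuousLinearMap.comp_apply]
  rw [Bundle.Trivialization.symmL_apply _ hx, Bundle.Trivialization.symm_apply_apply_mk _ hx,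
    Bundle.Trivialization.continuousLinearMapAt_apply_of_mem 𝕜 _ hy]

theorem trivializationAt_symmL_inCoordinates (hy : y ∈ (trivializationAt F' V' y₀).baseSet)
    (ϕ : V x →L[𝕜] V' y) (c : F) :
    (trivializationAt F' V' y₀).symmL 𝕜 y
        (ContinuousLinearMap.inCoordinates F V F' V' x₀ x y₀ y ϕ c) =
      ϕ ((trivializationAt F V x₀).symmL 𝕜 x c) :=
  Bundle.Trivialization.symmL_continuousLinearMapAt _ hy _

end HomBundle

section Coordinates

open FiberBundle

variable {E : Type*} [NormedAddCommGroup E] [NormedSpace ℝ E]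
  {B : Type*} [TopologicalSpace B] [ChartedSpace E B]
  {F : Type*} [NormedAddCommGroup F] [NormedSpace ℝ F]
  {N : Type*} [TopologicalSpace N] [ChartedSpace F N]

/-- The coordinatewise derivative `∑ dsⁱ e_i` of a vector field `s = ∑ sⁱ (e_i ∘ f)` along `f`, at
each point `q` in the coordinate frame `e_i` of the preferred chart at `f q`. It is the part of
`covAlong cov f s` that does not depend on `cov`. -/
noncomputable def coordDerivAlong [IsManifold 𝓘(ℝ, E) 1 B] (f : N → B)
    (s : Π q : N, TangentSpace 𝓘(ℝ, E) (f q)) (q : N) :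
    TangentSpace 𝓘(ℝ, F) q →L[ℝ] TangentSpace 𝓘(ℝ, E) (f q) :=
  ((trivializationAt E (TangentSpace 𝓘(ℝ, E)) (f q)).symmL ℝ (f q)).comp
    (mvfderiv 𝓘(ℝ, F)
      (fun q' ↦ (trivializationAt E (TangentSpace 𝓘(ℝ, E)) (f q) ⟨f q', s q'⟩).2) q)

theorem trivializationAt_symmL_apply_self [IsManifold 𝓘(ℝ, E) 1 B] {x : B}
    (u : TangentSpace 𝓘(ℝ, E) x) :
    (trivializationAt E (TangentSpace 𝓘(ℝ, E)) x).symmL ℝ x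
      (trivializationAt E (TangentSpace 𝓘(ℝ, E)) x ⟨x, u⟩).2 = u := by
  have hx := mem_baseSet_trivializationAt E (TangentSpace 𝓘(ℝ, E)) x
  rw [Bundle.Trivialization.symmL_apply _ hx]
  exact Bundle.Trivialization.symm_apply_apply_mk _ hx u

theorem isCovariantDerivativeOn_coordDerivAlong [IsManifold 𝓘(ℝ, E) 1 B] :
    IsCovariantDerivativeOn E (V := (TangentSpace 𝓘(ℝ, E) : B → Type _)) (I := 𝓘(ℝ, E))
      (fun Z x ↦ coordDerivAlong (fun y ↦ y) Z x) where
  add {σ τ x} hσ hτ _ := by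
    set e := trivializationAt E (TangentSpace 𝓘(ℝ, E) : B → Type _) x
    have hadd : (fun y ↦ (e ⟨y, (σ + τ) y⟩).2) =ᶠ[nhds x]
        (fun y ↦ (e ⟨y, σ y⟩).2) + (fun y ↦ (e ⟨y, τ y⟩).2) := by
      filter_upwards [e.open_baseSet.mem_nhds (mem_baseSet_trivializationAt' x)] with y hy
      exact (e.linear ℝ hy).1 (σ y) (τ y)
    simp only [coordDerivAlong]
    rw [mvfderiv_congr hadd, mvfderiv_add ((mdifferentiableAt_section _ σ).1 hσ)
      ((mdifferentiableAt_section _ τ).1 hτ), ContinuousLinearMap.comp_add]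
  leibniz {σ g x} hσ hg _ := by
    let e := trivializationAt E (TangentSpace 𝓘(ℝ, E) : B → Type _) x
    have hsmul : (fun y ↦ (e ⟨y, (g • σ) y⟩).2) =ᶠ[nhds x] g • fun y ↦ (e ⟨y, σ y⟩).2 := by
      filter_upwards [e.open_baseSet.mem_nhds (mem_baseSet_trivializationAt' x)] with y hy
      exact (e.linear ℝ hy).2 (g y) (σ y)
    ext v
    simp only [coordDerivAlong]
    rw [mvfderiv_congr hsmul, mvfderiv_smul hg ((mdifferentiableAt_section _ σ).1 hσ)]
    simp [trivializationAt_symmL_apply_self]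

theorem coordDerivAlong_extend [IsManifold 𝓘(ℝ, E) 1 B] {x : B} (u : TangentSpace 𝓘(ℝ, E) x) :
    coordDerivAlong (E := E) (F := E) (fun y ↦ y) (extend E u) x = 0 := by
  set e := trivializationAt E (TangentSpace 𝓘(ℝ, E) : B → Type _) x
  have hconst : (fun y ↦ (e ⟨y, extend E u y⟩).2) =ᶠ[nhds x] fun _ ↦ (e ⟨x, u⟩).2 := by
    filter_upwards [e.open_baseSet.mem_nhds (mem_baseSet_trivializationAt' x)] with y hy
    exact e.apply_mk_symm hy _ ▸ rfl
  rw [coordDerivAlong, mvfderiv_congr hconst, mvfderiv_const, ContinuousLinearMap.comp_zero]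

theorem cov_eq_coordDerivAlong_add [FiniteDimensional ℝ E] [IsManifold 𝓘(ℝ, E) ∞ B]
    (cov : CovariantDerivative 𝓘(ℝ, E) E (TangentSpace 𝓘(ℝ, E) : B → Type _))
    {Z : Π x : B, TangentSpace 𝓘(ℝ, E) x} {x : B} (hZ : MDiffAt (T% Z) x) :
    cov Z x = coordDerivAlong (fun y ↦ y) Z x + cov (extend E (Z x)) x := by
  have hdiff {σ : Π x : B, TangentSpace 𝓘(ℝ, E) x} (hσ : MDiffAt (T% σ) x) :=
    cov.isCovariantDerivativeOnUniv.difference_apply isCovariantDerivativeOn_coordDerivAlong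
      trivial hσ
  have hext := hdiff (mdifferentiableAt_extend 𝓘(ℝ, E) E (Z x))
  rw [extend_apply_self, hdiff hZ, coordDerivAlong_extend, sub_zero] at hext
  rw [← hext, add_sub_cancel]

theorem covAlong_eq_coordDerivAlong_add [IsManifold 𝓘(ℝ, E) ∞ B]
    (cov : CovariantDerivative 𝓘(ℝ, E) E (TangentSpace 𝓘(ℝ, E) : B → Type _)) (f : N → B)
    (s : Π q : N, TangentSpace 𝓘(ℝ, E) (f q)) (q : N) (v : TangentSpace 𝓘(ℝ, F) q) :
    covAlong cov f s q v = coordDerivAlong f s q v +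
      cov (extend E (s q)) (f q) (mfderiv 𝓘(ℝ, F) 𝓘(ℝ, E) f q v) := by
  rw [coordDerivAlong, ContinuousLinearMap.comp_apply,
    Bundle.Trivialization.symmL_apply _ (mem_baseSet_trivializationAt' (f q)), covAlong]

theorem coordDerivAlong_clm_apply [IsManifold 𝓘(ℝ, E) 1 B]
    {ψ : Π x : B, TangentSpace 𝓘(ℝ, E) x →L[ℝ] TangentSpace 𝓘(ℝ, E) x} {f : N → B}
    {s : Π q : N, TangentSpace 𝓘(ℝ, E) (f q)} {q : N}
    (hψ : MDifferentiableAt 𝓘(ℝ, E) (𝓘(ℝ, E).prod 𝓘(ℝ, E →L[ℝ] E))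
      (fun x ↦ (⟨x, ψ x⟩ : Bundle.TotalSpace (E →L[ℝ] E)
        (fun x : B ↦ TangentSpace 𝓘(ℝ, E) x →L[ℝ] TangentSpace 𝓘(ℝ, E) x))) (f q))
    (hf : MDifferentiableAt 𝓘(ℝ, F) 𝓘(ℝ, E) f q)
    (hs : MDifferentiableAt 𝓘(ℝ, F) 𝓘(ℝ, E).tangent
      (fun q' ↦ (⟨f q', s q'⟩ : TangentBundle 𝓘(ℝ, E) B)) q) (v : TangentSpace 𝓘(ℝ, F) q) :
    coordDerivAlong f (fun q' ↦ ψ (f q') (s q')) q v =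
      ψ (f q) (coordDerivAlong f s q v) +
        coordDerivAlong (fun y ↦ y) (fun y ↦ ψ y (extend E (s q) y)) (f q)
          (mfderiv 𝓘(ℝ, F) 𝓘(ℝ, E) f q v) := by
  set e := trivializationAt E (TangentSpace 𝓘(ℝ, E) : B → Type _) (f q)
  let A : B → E →L[ℝ] E := fun y ↦ ContinuousLinearMap.inCoordinates E (TangentSpace 𝓘(ℝ, E)) E
    (TangentSpace 𝓘(ℝ, E)) (f q) y (f q) y (ψ y)
  have hA : MDiffAt A (f q) := ((mdifferentiableAt_hom_bundle _).1 hψ).2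
  have hs' : MDiffAt (fun q' ↦ (e ⟨f q', s q'⟩).2) q := ((mdifferentiableAt_totalSpace _ _).1 hs).2
  have hbase : f q ∈ e.baseSet := mem_baseSet_trivializationAt' (f q)
  have hnhds := e.open_baseSet.mem_nhds hbase
  have hψs : (fun q' ↦ (e ⟨f q', ψ (f q') (s q')⟩).2) =ᶠ[nhds q]
      fun q' ↦ A (f q') (e ⟨f q', s q'⟩).2 := by
    filter_upwards [hf.continuousAt hnhds] with q' hq'
    exact trivializationAt_clm_apply hq' hq' _ _
  have hψext : (fun y ↦ (e ⟨y, ψ y (extend E (s q) y)⟩).2) =ᶠ[nhds (f q)]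
      fun y ↦ A y (e ⟨f q, s q⟩).2 := by
    filter_upwards [hnhds] with y hy
    rw [trivializationAt_clm_apply hy hy]
    exact congrArg (A y) (e.apply_mk_symm hy _ ▸ rfl)
  have hAf : mvfderiv 𝓘(ℝ, F) (fun q' ↦ A (f q')) q v =
      mvfderiv 𝓘(ℝ, E) A (f q) (mfderiv 𝓘(ℝ, F) 𝓘(ℝ, E) f q v) := mfderiv_comp_apply q hA hf v
  simp only [coordDerivAlong, ContinuousLinearMap.comp_apply]
  rw [mvfderiv_congr hψs, mvfderiv_congr hψext,
    mvfderiv_clm_apply (A := fun q' ↦ A (f q')) (hA.comp q hf) hs', map_add, hAf,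
    mvfderiv_clm_apply hA mdifferentiableAt_const, mvfderiv_const,
    trivializationAt_symmL_inCoordinates hbase]
  simp [e]

theorem covAlong_clm_apply [FiniteDimensional ℝ E] [IsManifold 𝓘(ℝ, E) ∞ B]
    (cov : CovariantDerivative 𝓘(ℝ, E) E (TangentSpace 𝓘(ℝ, E) : B → Type _))
    {ψ : Π x : B, TangentSpace 𝓘(ℝ, E) x →L[ℝ] TangentSpace 𝓘(ℝ, E) x} {f : N → B}
    {s : Π q : N, TangentSpace 𝓘(ℝ, E) (f q)} {q : N}
    (hψ : MDifferentiableAt 𝓘(ℝ, E) (𝓘(ℝ, E).prod 𝓘(ℝ, E →L[ℝ] E))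
      (fun x ↦ (⟨x, ψ x⟩ : Bundle.TotalSpace (E →L[ℝ] E)
        (fun x : B ↦ TangentSpace 𝓘(ℝ, E) x →L[ℝ] TangentSpace 𝓘(ℝ, E) x))) (f q))
    (hf : MDifferentiableAt 𝓘(ℝ, F) 𝓘(ℝ, E) f q)
    (hs : MDifferentiableAt 𝓘(ℝ, F) 𝓘(ℝ, E).tangent
      (fun q' ↦ (⟨f q', s q'⟩ : TangentBundle 𝓘(ℝ, E) B)) q) (v : TangentSpace 𝓘(ℝ, F) q) :
    covAlong cov f (fun q' ↦ ψ (f q') (s q')) q v =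
      ψ (f q) (covAlong cov f s q v) +
        (cov (fun y ↦ ψ y (extend E (s q) y)) (f q) (mfderiv 𝓘(ℝ, F) 𝓘(ℝ, E) f q v) -
          ψ (f q) (cov (extend E (s q)) (f q) (mfderiv 𝓘(ℝ, F) 𝓘(ℝ, E) f q v))) := by
  have hψext := hψ.clm_bundle_apply (mdifferentiableAt_extend 𝓘(ℝ, E) E (s q))
  rw [covAlong_eq_coordDerivAlong_add, covAlong_eq_coordDerivAlong_add,
    coordDerivAlong_clm_apply hψ hf hs, cov_eq_coordDerivAlong_add cov hψext, extend_apply_self,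
    add_apply, map_add]
  abel

theorem mdifferentiableAt_push [IsManifold 𝓘(ℝ, E) 1 B] [IsManifold 𝓘(ℝ, F) 1 N] {f : N → B}
    {p : N} (hf : ContMDiff 𝓘(ℝ, F) 𝓘(ℝ, E) 2 f) {X : Π q : N, TangentSpace 𝓘(ℝ, F) q}
    (hX : MDiffAt (T% X) p) :
    MDifferentiableAt 𝓘(ℝ, F) 𝓘(ℝ, E).tangent
      (fun q ↦ (⟨f q, push E f X q⟩ : TangentBundle 𝓘(ℝ, E) B)) p :=
  ((hf.contMDiff_tangentMap (m := 1) (by norm_num)).mdifferentiable (by simp) _).comp p hX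

theorem coordDerivAlong_push_sub [IsManifold 𝓘(ℝ, E) 2 B] [IsManifold 𝓘(ℝ, F) 2 N] {f : N → B}
    {p : N} (hf : ContMDiffAt 𝓘(ℝ, F) 𝓘(ℝ, E) 2 f p) {X Y : Π q : N, TangentSpace 𝓘(ℝ, F) q}
    (hX : MDiffAt (T% X) p) (hY : MDiffAt (T% Y) p) :
    coordDerivAlong f (push E f Y) p (X p) - coordDerivAlong f (push E f X) p (Y p) =
      push E f (VectorField.mlieBracket 𝓘(ℝ, F) X Y) p := by
  have hp := mem_chart_source E (f p)
  have hcoord (Z : Π q : N, TangentSpace 𝓘(ℝ, F) q) :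
      (fun q ↦ (trivializationAt E (TangentSpace 𝓘(ℝ, E)) (f p) ⟨f q, push E f Z q⟩).2)
        =ᶠ[nhds p] dirDeriv Z (extChartAt 𝓘(ℝ, E) (f p) ∘ f) := by
    filter_upwards [hf.continuousAt ((chartAt E (f p)).open_source.mem_nhds hp),
      (contMDiffAt_iff_contMDiffAt_nhds (by simp)).1 hf] with q hq hfq
    rw [trivializationAt_apply_eq_mvfderiv_extChartAt hq]
    exact (mfderiv_comp_apply q (mdifferentiableAt_extChartAt hq)
      (hfq.mdifferentiableAt (by simp)) (Z q)).symm
  have hφf : ContMDiffAt 𝓘(ℝ, F) 𝓘(ℝ, E) 2 (extChartAt 𝓘(ℝ, E) (f p) ∘ f) p :=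
    contMDiffAt_extChartAt.comp p hf
  simp only [coordDerivAlong, ContinuousLinearMap.comp_apply]
  rw [mvfderiv_congr (hcoord X), mvfderiv_congr (hcoord Y), ← map_sub]
  refine (congrArg _ (dirDeriv_mlieBracket hφf hX hY).symm).trans ?_
  rw [← (hcoord _).self_of_nhds]
  exact trivializationAt_symmL_apply_self _

end Coordinates

section Torsion

open FiberBundle VectorField

variable {E : Type*} [NormedAddCommGroup E] [NormedSpace ℝ E]
  {B : Type*} [TopologicalSpace B] [ChartedSpace E B]

theorem push_fun_id (Z : Π x : B, TangentSpace 𝓘(ℝ, E) x) : push E (fun y ↦ y) Z = Z := by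
  ext x
  exact congrArg (fun T ↦ T (Z x)) (mfderiv_id (I := 𝓘(ℝ, E)) (x := x))

theorem mlieBracket_extend_extend [IsManifold 𝓘(ℝ, E) 2 B] {x : B}
    (u v : TangentSpace 𝓘(ℝ, E) x) :
    mlieBracket 𝓘(ℝ, E) (extend E u) (extend E v) x = 0 := by
  have h := coordDerivAlong_push_sub contMDiffAt_id (mdifferentiableAt_extend 𝓘(ℝ, E) E u)
    (mdifferentiableAt_extend 𝓘(ℝ, E) E v)
  change coordDerivAlong (fun y ↦ y) (push E (fun y ↦ y) _) x _ -
    coordDerivAlong (fun y ↦ y) (push E (fun y ↦ y) _) x _ = push E (fun y ↦ y) _ x at h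
  simpa only [push_fun_id, coordDerivAlong_extend, zero_apply, sub_zero, eq_comm] using h

variable [FiniteDimensional ℝ E] [IsManifold 𝓘(ℝ, E) ∞ B]
  {cov : CovariantDerivative 𝓘(ℝ, E) E (TangentSpace 𝓘(ℝ, E) : B → Type _)}

theorem cov_extend_apply_comm (hcov : cov.torsion = 0) {x : B} (u v : TangentSpace 𝓘(ℝ, E) x) :
    cov (extend E v) x u = cov (extend E u) x v := by
  have htorsion := cov.torsion_apply_eq_extend u v
  rw [hcov, mlieBracket_extend_extend, sub_zero, extend_apply_self, extend_apply_self] at htorsion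
  exact sub_eq_zero.1 htorsion.symm

theorem covAlong_push_sub {F : Type*} [NormedAddCommGroup F] [NormedSpace ℝ F]
    {N : Type*} [TopologicalSpace N] [ChartedSpace F N] [IsManifold 𝓘(ℝ, F) 2 N]
    (hcov : cov.torsion = 0) {f : N → B} {p : N} (hf : ContMDiffAt 𝓘(ℝ, F) 𝓘(ℝ, E) 2 f p)
    {X Y : Π q : N, TangentSpace 𝓘(ℝ, F) q} (hX : MDiffAt (T% X) p) (hY : MDiffAt (T% Y) p) :
    covAlong cov f (push E f Y) p (X p) - covAlong cov f (push E f X) p (Y p) =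
      push E f (mlieBracket 𝓘(ℝ, F) X Y) p := by
  have hcomm : cov (extend E (push E f Y p)) (f p) (mfderiv 𝓘(ℝ, F) 𝓘(ℝ, E) f p (X p)) =
      cov (extend E (push E f X p)) (f p) (mfderiv 𝓘(ℝ, F) 𝓘(ℝ, E) f p (Y p)) :=
    cov_extend_apply_comm hcov _ _
  rw [covAlong_eq_coordDerivAlong_add, covAlong_eq_coordDerivAlong_add, hcomm,
    add_sub_add_right_eq_sub, coordDerivAlong_push_sub hf hX hY]

end Torsion

section TransSasakian

open VectorField

theorem inner_starProjection_starProjection_eq_zero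
    {T : Type*} [NormedAddCommGroup T] [InnerProductSpace ℝ T]
    {R : Submodule ℝ T} [R.HasOrthogonalProjection] {ψ : T → T} {ξ : T}
    (hψ : ∀ v w, (inner ℝ (ψ v) (ψ w) : ℝ) = inner ℝ v w - inner ℝ v ξ * inner ℝ w ξ)
    {v U : T} (hv : v ∈ R) (hψv : ψ v ∈ Rᗮ) (hξ : ξ ∈ Rᗮ) (hU : U ∈ Rᗮ) :
    (inner ℝ (Rᗮ.starProjection (ψ v)) (Rᗮ.starProjection (ψ U)) : ℝ) = 0 := by
  rw [Submodule.starProjection_eq_self_iff.2 hψv, ← Submodule.inner_starProjection_left_eq_right,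
    Submodule.starProjection_eq_self_iff.2 hψv, hψ, hU v hv, hξ v hv, zero_mul, sub_zero]

variable {E : Type*} [NormedAddCommGroup E] [NormedSpace ℝ E]
  {B : Type*} [TopologicalSpace B] [ChartedSpace E B] [IsManifold 𝓘(ℝ, E) ∞ B]
  [RiemannianBundle (fun x : B ↦ TangentSpace 𝓘(ℝ, E) x)]
  {ψ : Π x : B, TangentSpace 𝓘(ℝ, E) x →L[ℝ] TangentSpace 𝓘(ℝ, E) x}
  {ξ : Π x : B, TangentSpace 𝓘(ℝ, E) x} {η : Π x : B, TangentSpace 𝓘(ℝ, E) x →L[ℝ] ℝ}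

theorem IsAlmostContactMetric.inner_psi_psi_eq (hB : IsAlmostContactMetric ψ ξ η) {x : B}
    (v w : TangentSpace 𝓘(ℝ, E) x) :
    (inner ℝ (ψ x v) (ψ x w) : ℝ) = inner ℝ v w - inner ℝ v (ξ x) * inner ℝ w (ξ x) := by
  rw [hB.inner_psi_psi, hB.eta_eq_inner, hB.eta_eq_inner]

variable [FiniteDimensional ℝ E]
  {cov : CovariantDerivative 𝓘(ℝ, E) E (TangentSpace 𝓘(ℝ, E) : B → Type _)} {α β : B → ℝ}
  {F : Type*} [NormedAddCommGroup F] [NormedSpace ℝ F]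
  {N : Type*} [TopologicalSpace N] [ChartedSpace F N] {f : N → B} {p : N}

theorem IsTransSasakian.covAlong_psi (hB : IsTransSasakian cov ψ ξ η α β)
    (hf : MDifferentiableAt 𝓘(ℝ, F) 𝓘(ℝ, E) f p) {s : Π q : N, TangentSpace 𝓘(ℝ, E) (f q)}
    (hs : MDifferentiableAt 𝓘(ℝ, F) 𝓘(ℝ, E).tangent
      (fun q ↦ (⟨f q, s q⟩ : TangentBundle 𝓘(ℝ, E) B)) p) {w : TangentSpace 𝓘(ℝ, F) p}
    (hsξ : (inner ℝ (s p) (ξ (f p)) : ℝ) = 0)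
    (hψs : (inner ℝ (ψ (f p) (mfderiv 𝓘(ℝ, F) 𝓘(ℝ, E) f p w)) (s p) : ℝ) = 0) :
    covAlong cov f (fun q ↦ ψ (f q) (s q)) p w = ψ (f p) (covAlong cov f s p w) +
      α (f p) • (inner ℝ (mfderiv 𝓘(ℝ, F) 𝓘(ℝ, E) f p w) (s p) : ℝ) • ξ (f p) := by
  rw [covAlong_clm_apply cov (hB.smooth_psi.mdifferentiable (by simp) _) hf hs,
    hB.cov_psi _ _ _ (FiberBundle.mdifferentiableAt_extend 𝓘(ℝ, E) E _)]
  simp [hB.eta_eq_inner, hsξ, hψs]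

theorem IsTransSasakian.covAlong_psi_push_sub [IsManifold 𝓘(ℝ, F) 2 N]
    (hB : IsTransSasakian cov ψ ξ η α β) (hcov : cov.torsion = 0)
    (hf : ContMDiff 𝓘(ℝ, F) 𝓘(ℝ, E) 2 f)
    (hanti : ∀ v ∈ rangeAt F E f p, ψ (f p) v ∈ (rangeAt F E f p)ᗮ)
    (hξ : ξ (f p) ∈ (rangeAt F E f p)ᗮ)
    {W Y : Π q : N, TangentSpace 𝓘(ℝ, F) q} (hW : MDiffAt (T% W) p) (hY : MDiffAt (T% Y) p) :
    covAlong cov f (fun q ↦ ψ (f q) (push E f Y q)) p (W p) -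
        covAlong cov f (fun q ↦ ψ (f q) (push E f W q)) p (Y p) =
      ψ (f p) (push E f (mlieBracket 𝓘(ℝ, F) W Y) p) := by
  have hmem (X : Π q : N, TangentSpace 𝓘(ℝ, F) q) : push E f X p ∈ rangeAt F E f p := ⟨_, rfl⟩
  have hcovψ {X Z : Π q : N, TangentSpace 𝓘(ℝ, F) q} (hX : MDiffAt (T% X) p) :
      covAlong cov f (fun q ↦ ψ (f q) (push E f X q)) p (Z p) =
        ψ (f p) (covAlong cov f (push E f X) p (Z p)) +
          α (f p) • (inner ℝ (push E f Z p) (push E f X p) : ℝ) • ξ (f p) :=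
    hB.covAlong_psi (hf.mdifferentiable (by simp) p) (mdifferentiableAt_push hf hX)
      (hξ _ (hmem X)) (Submodule.inner_left_of_mem_orthogonal (hmem X) (hanti _ (hmem Z)))
  rw [hcovψ hY, hcovψ hW, real_inner_comm, add_sub_add_right_eq_sub, ← map_sub,
    covAlong_push_sub hcov hf.contMDiffAt hW hY]

end TransSasakian

end ClairautMap

theorem theorem3p5_general
    {E₁ : Type*} [NormedAddCommGroup E₁] [NormedSpace ℝ E₁] [FiniteDimensional ℝ E₁]
    {M : Type*} [TopologicalSpace M] [ChartedSpace E₁ M] [IsManifold 𝓘(ℝ, E₁) 2 M]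
    {E : Type*} [NormedAddCommGroup E] [NormedSpace ℝ E] [FiniteDimensional ℝ E]
    {B : Type*} [TopologicalSpace B] [ChartedSpace E B] [IsManifold 𝓘(ℝ, E) ∞ B]
    [RiemannianBundle (fun x : B ↦ TangentSpace 𝓘(ℝ, E) x)]
    {cov : CovariantDerivative 𝓘(ℝ, E) E (TangentSpace 𝓘(ℝ, E) : B → Type _)}
    (hcov : cov.torsion = 0)
    {ψ : Π x : B, TangentSpace 𝓘(ℝ, E) x →L[ℝ] TangentSpace 𝓘(ℝ, E) x}
    {ξ : Π x : B, TangentSpace 𝓘(ℝ, E) x} {η : Π x : B, TangentSpace 𝓘(ℝ, E) x →L[ℝ] ℝ}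
    {α β : B → ℝ} (hB : ClairautMap.IsTransSasakian cov ψ ξ η α β)
    {f : M → B} (hf : ContMDiff 𝓘(ℝ, E₁) 𝓘(ℝ, E) 2 f) {p : M}
    (hanti : ∀ v ∈ ClairautMap.rangeAt E₁ E f p, ψ (f p) v ∈ (ClairautMap.rangeAt E₁ E f p)ᗮ)
    (hξ : ξ (f p) ∈ (ClairautMap.rangeAt E₁ E f p)ᗮ)
    {W Y : Π q : M, TangentSpace 𝓘(ℝ, E₁) q} (hW : MDiffAt (T% W) p) (hY : MDiffAt (T% Y) p)
    {U : TangentSpace 𝓘(ℝ, E) (f p)} (hU : U ∈ (ClairautMap.rangeAt E₁ E f p)ᗮ) :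
    (inner ℝ
      (ClairautMap.normalCov cov f (fun q ↦ ψ (f q) (ClairautMap.push E f Y q)) p (W p)
        - ClairautMap.normalCov cov f (fun q ↦ ψ (f q) (ClairautMap.push E f W q)) p (Y p))
      (ClairautMap.normalPart E₁ f ψ p U) : ℝ) = 0 := by
  rw [ClairautMap.normalCov, ClairautMap.normalCov, ← map_sub,
    hB.covAlong_psi_push_sub hcov hf hanti hξ hW hY]
  have hmem : ClairautMap.push E f (VectorField.mlieBracket 𝓘(ℝ, E₁) W Y) p ∈
      ClairautMap.rangeAt E₁ E f p := ⟨_, rfl⟩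
  exact ClairautMap.inner_starProjection_starProjection_eq_zero (ψ := ψ (f p))
    hB.inner_psi_psi_eq hmem (hanti _ hmem) hξ hU

theorem theorem3p5
    {E₁ : Type*} [NormedAddCommGroup E₁] [NormedSpace ℝ E₁] [FiniteDimensional ℝ E₁]
    {M : Type*} [TopologicalSpace M] [T2Space M] [SecondCountableTopology M]
    [ChartedSpace E₁ M] [IsManifold 𝓘(ℝ, E₁) ∞ M]
    [RiemannianBundle (fun x : M ↦ TangentSpace 𝓘(ℝ, E₁) x)]
    [IsContMDiffRiemannianBundle 𝓘(ℝ, E₁) ∞ E₁ (fun x : M ↦ TangentSpace 𝓘(ℝ, E₁) x)]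
    {E : Type*} [NormedAddCommGroup E] [NormedSpace ℝ E] [FiniteDimensional ℝ E]
    {B : Type*} [TopologicalSpace B] [T2Space B] [SecondCountableTopology B]
    [ChartedSpace E B] [IsManifold 𝓘(ℝ, E) ∞ B]
    [RiemannianBundle (fun x : B ↦ TangentSpace 𝓘(ℝ, E) x)]
    [IsContMDiffRiemannianBundle 𝓘(ℝ, E) ∞ E (fun x : B ↦ TangentSpace 𝓘(ℝ, E) x)]
    (cov : CovariantDerivative 𝓘(ℝ, E) E (TangentSpace 𝓘(ℝ, E) : B → Type _))
    (hcov : ClairautMap.IsLeviCivita cov)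
    (ψ : Π x : B, TangentSpace 𝓘(ℝ, E) x →L[ℝ] TangentSpace 𝓘(ℝ, E) x)
    (ξ : Π x : B, TangentSpace 𝓘(ℝ, E) x)
    (η : Π x : B, TangentSpace 𝓘(ℝ, E) x →L[ℝ] ℝ)
    (α β : B → ℝ)
    (hB : ClairautMap.IsTransSasakian cov ψ ξ η α β)
    (f : M → B)
    (hmap : ClairautMap.IsRiemannianMap (E₁ := E₁) (E := E) f)
    (hanti : ClairautMap.IsAntiInvariant (E₁ := E₁) f ψ)
    (hclairaut : ClairautMap.IsClairaut (E₁ := E₁) cov f)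
    (hξ : ∀ p : M, ξ (f p) ∈ (ClairautMap.rangeAt E₁ E f p)ᗮ)
    (hint : ClairautMap.IsIntegrableRange E₁ E f)
    (W Y : Π p : M, TangentSpace 𝓘(ℝ, E₁) p)
    (hW : ClairautMap.IsHorizontalField E f W)
    (hY : ClairautMap.IsHorizontalField E f Y)
    (p : M) (U : TangentSpace 𝓘(ℝ, E) (f p))
    (hU : U ∈ (ClairautMap.rangeAt E₁ E f p)ᗮ) :
    (inner ℝ
      (ClairautMap.normalCov cov f (fun q ↦ ψ (f q) (ClairautMap.push E f Y q)) p (W p)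
        - ClairautMap.normalCov cov f (fun q ↦ ψ (f q) (ClairautMap.push E f W q)) p (Y p))
      (ClairautMap.normalPart E₁ f ψ p U) : ℝ) = 0 :=
  theorem3p5_general hcov.torsion_eq_zero hB (hmap.smooth.of_le ENat.LEInfty.out) (hanti p) (hξ p)
    (hW.smooth.mdifferentiable (by simp) p) (hY.smooth.mdifferentiable (by simp) p) hU
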